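/- Let $G$ be a group. An element $g\in G$ is \emph{reversible} (in $G$) if there is $h\in G$ with $hgh^{-1}=g^{-1}$, and an \emph{involution} if $g^2=1$ (so the identity counts as an involution). For $n\ge 1$ let $I_n(G)$ be the set of all products $\tau_1\tau_2\cdots\tau_n$ of $n$ involutions of $G$, and let $R_n(G)$ be the set of all products $g_1g_2\cdots g_n$ of $n$ reversible elements of $G$. Let $\mathrm{H}(\mathbb{R})$ be the group of all homeomorphisms of the real line under composition, $\mathrm{PLF}(\mathbb{R})$ its subgroup of homeomorphisms that are locally affine at all but finitely many points of $\mathbb{R}$, and $\mathrm{PL}(\mathbb{R})$ its subgroup of homeomorphisms that are locally affine at all but a discrete set of points of $\mathbb{R}$. Let $\mathrm{H}^+(\mathbb{R})$, $\mathrm{PLF}^+(\mathbb{R})$ and $\mathrm{PL}^+(\mathbb{R})$ be the subgroups of strictly increasing maps in these three groups. Then: \begin{enumerate} \item[(i)] $\mathrm{H}^+(\mathbb{R})=R_2(\mathrm{H}^+(\mathbb{R}))$ and $\mathrm{H}(\mathbb{R})=R_2(\mathrm{H}(\mathbb{R}))$; \item[(ii)] for each integer $n\ge 1$, $R_n(\mathrm{PLF}^+(\mathbb{R}))$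 contains only the identity element, and $I_{2n}(\mathrm{PLF}(\mathbb{R}))=R_n(\mathrm{PLF}(\mathbb{R}))$; \item[(iii)] $\mathrm{PL}^+(\mathbb{R})=R_4(\mathrm{PL}^+(\mathbb{R}))$ and $\mathrm{PL}(\mathbb{R})=R_2(\mathrm{PL}(\mathbb{R}))$. \end{enumerate} -/

import Mathlib

open Filter Topology

namespace RealLineHomeo

/-- An element `g` of a group is reversible if it is conjugate, within the group, to its inverse. -/
def IsReversible {G : Type*} [Group G] (g : G) : Prop :=
  ∃ h : G, h * g * h⁻¹ = g⁻¹

/-- An involution is an element whose square is the identity (the identity is one). -/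
def IsInvolution {G : Type*} [Group G] (g : G) : Prop :=
  g ^ 2 = 1

/-- `I n G` is the set of products `τ₁ τ₂ ⋯ τₙ` of `n` involutions of `G`. -/
def I (n : ℕ) (G : Type*) [Group G] : Set G :=
  {g | ∃ l : List G, l.length = n ∧ (∀ t ∈ l, IsInvolution t) ∧ l.prod = g}

/-- `R n G` is the set of products `g₁ g₂ ⋯ gₙ` of `n` reversible elements of `G`. -/
def R (n : ℕ) (G : Type*) [Group G] : Set G :=
  {g | ∃ l : List G, l.length = n ∧ (∀ t ∈ l, IsReversible t) ∧ l.prod = g}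

/-- The group `H(ℝ)` of all homeomorphisms of the real line, under composition. -/
abbrev H : Type := ℝ ≃ₜ ℝ

/-- The map `f` coincides with an affine map in a neighbourhood of `x`. -/
def LocallyAffineAt (f : ℝ → ℝ) (x : ℝ) : Prop :=
  ∃ a b : ℝ, ∀ᶠ y in 𝓝 x, f y = a * y + b

/-- The set of points at which `f` is not locally affine. -/
def breakSet (f : ℝ → ℝ) : Set ℝ :=
  {x | ¬ LocallyAffineAt f x}

theorem breakSet_id : breakSet (fun x => x) = ∅ := by
  refine Set.eq_empty_of_forall_notMem fun x hx => hx ⟨1, 0, ?_⟩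
  exact Eventually.of_forall fun y => by ring

theorem isClosed_breakSet (f : ℝ → ℝ) : IsClosed (breakSet f) := by
  rw [← isOpen_compl_iff, isOpen_iff_mem_nhds]
  intro x hx
  obtain ⟨a, b, h⟩ := not_not.mp hx
  filter_upwards [h.eventually_nhds] with y hy
  exact not_not.mpr ⟨a, b, hy⟩

theorem breakSet_mul (f g : H) : breakSet (f * g : H) ⊆ breakSet g ∪ g ⁻¹' breakSet f := by
  intro x hx
  by_contra hn
  simp only [Set.mem_union, Set.mem_preimage, not_or] at hn
  obtain ⟨a, b, h⟩ := not_not.mp hn.1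
  obtain ⟨c, d, k⟩ := not_not.mp hn.2
  refine hx ⟨c * a, c * b + d, ?_⟩
  filter_upwards [h, g.continuous.continuousAt.eventually k] with y hy hk
  change f (g y) = _
  rw [hk, hy]
  ring

theorem breakSet_inv (f : H) : breakSet (f⁻¹ : H) ⊆ (f⁻¹ : H) ⁻¹' breakSet f := by
  intro x hx hn
  obtain ⟨a, b, h⟩ := hn
  have hf : ∀ y, f ((f⁻¹ : H) y) = y := f.apply_symm_apply
  have h' := (f⁻¹ : H).continuous.continuousAt.eventually h
  have ha : a ≠ 0 := by
    rintro rfl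
    have h2 : ∀ᶠ y in 𝓝[≠] x, y = b := by
      filter_upwards [nhdsWithin_le_nhds h'] with y hy
      rw [hf] at hy
      simpa using hy
    have hxb : x = b := by
      have := h'.self_of_nhds
      rw [hf] at this
      simpa using this
    obtain ⟨y, hy, hyx⟩ := (h2.and self_mem_nhdsWithin).exists
    exact hyx (hy.trans hxb.symm)
  refine hx ⟨a⁻¹, -(a⁻¹ * b), ?_⟩
  filter_upwards [h'] with y hy
  rw [hf] at hy
  field_simp
  linarith

theorem isDiscrete_union {s t : Set ℝ} (hs : IsClosed s) (ht : IsClosed t)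
    (hs' : IsDiscrete s) (ht' : IsDiscrete t) : IsDiscrete (s ∪ t) := by
  have h1 : sᶜ ∈ codiscrete ℝ :=
    mem_codiscrete'.mpr ⟨hs.isOpen_compl, by rwa [compl_compl]⟩
  have h2 : tᶜ ∈ codiscrete ℝ :=
    mem_codiscrete'.mpr ⟨ht.isOpen_compl, by rwa [compl_compl]⟩
  have h := (mem_codiscrete'.mp (inter_mem h1 h2)).2
  rwa [Set.compl_inter, compl_compl, compl_compl] at h

theorem isDiscrete_preimage (g : H) {s : Set ℝ} (hs : IsDiscrete s) : IsDiscrete (g ⁻¹' s) :=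
  hs.preimage g.continuous.continuousOn g.injective

/-- `H⁺(ℝ)`: the orientation preserving (strictly increasing) homeomorphisms. -/
def HPlus : Subgroup H where
  carrier := {f | StrictMono f}
  one_mem' := strictMono_id
  mul_mem' := fun hf hg => hf.comp hg
  inv_mem' := by
    intro f hf x y hxy
    have h : f ((f⁻¹ : H) x) < f ((f⁻¹ : H) y) := by
      have e : ∀ z, f ((f⁻¹ : H) z) = z := f.apply_symm_apply
      rwa [e, e]
    exact hf.lt_iff_lt.mp h

/-- `PLF(ℝ)`: the homeomorphisms that are locally affine at all but finitely many points. -/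
def PLF : Subgroup H where
  carrier := {f | (breakSet f).Finite}
  one_mem' := by
    change (breakSet (fun x => x)).Finite
    rw [breakSet_id]
    exact Set.finite_empty
  mul_mem' := by
    intro f g hf hg
    exact (Set.Finite.union hg (Set.Finite.preimage g.injective.injOn hf)).subset
      (breakSet_mul f g)
  inv_mem' := by
    intro f hf
    exact (Set.Finite.preimage (f⁻¹ : H).injective.injOn hf).subset (breakSet_inv f)

/-- `PL(ℝ)`: the homeomorphisms that are locally affine at all but a discrete set of points. -/
def PL : Subgroup H where
  carrier := {f | IsDiscrete (breakSet f)}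
  one_mem' := by
    change IsDiscrete (breakSet (fun x => x))
    rw [breakSet_id]
    exact Set.subsingleton_empty.isDiscrete
  mul_mem' := by
    intro f g hf hg
    exact (isDiscrete_union (isClosed_breakSet g) ((isClosed_breakSet f).preimage g.continuous)
      hg (isDiscrete_preimage g hf)).mono (breakSet_mul f g)
  inv_mem' := by
    intro f hf
    exact (isDiscrete_preimage (f⁻¹ : H) hf).mono (breakSet_inv f)

/-- `PLF⁺(ℝ)`: the orientation preserving members of `PLF(ℝ)`. -/
def PLFPlus : Subgroup H := PLF ⊓ HPlus

/-- `PL⁺(ℝ)`: the orientation preserving members of `PL(ℝ)`. -/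
def PLPlus : Subgroup H := PL ⊓ HPlus

end RealLineHomeo

namespace RealLineHomeo

/-! ### Germs of affine maps -/

/-! Rigidity in `PLF` comes from germs. If increasing `g`, `h` satisfy `g ∘ h ∘ g = h`, comparing
affine germs at a common fixed end forces `g` to be the identity there; starting at `+∞` and moving
to the supremum of the non-fixed points gives `g = 1` (`eq_one_of_reversed_PLF`). Hence in `PLF`
only decreasing maps reverse a nontrivial increasing `g`. If `h` does, then `k = max h h⁻¹` is an
involution that also reverses `g`, and `g = k * (k * g)`. A reversible decreasing `g` is itself an
involution.

Elsewhere the model is the unit translation, to which every increasing map above the identity is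
conjugate, inside `PL` if the map lies there (`exists_conj_translation`). Since `x ↦ -x` reverses
translations, such maps are reversible in `H` and `PL`. An increasing map is a quotient of two of
them, and a decreasing map is an involution times one of them.

Among increasing maps the reflection is not available. Instead a periodic zigzag `Z`, reversed by
the half translation, has a conjugate `κ Z κ⁻¹` equal to `Z` followed by a small translation, so a
translation is a product of two reversible elements of `PL⁺` (`unitTranslation_mem_R_two`). Two such
factors give the four of `PL⁺`. In `H⁺` two suffice, because any `f` is the image of the unit
translation under an endomorphism of `H⁺` (`exists_hom_translation`). -/

/-- The map `f` coincides with an affine map along the filter `l`. -/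
def AffineGerm (l : Filter ℝ) (f : ℝ → ℝ) : Prop :=
  ∃ a b : ℝ, ∀ᶠ y in l, f y = a * y + b

/-- Along the filter `l` every affine map has a constant sign. -/
def SignFilter (l : Filter ℝ) : Prop :=
  ∀ a b : ℝ, (∀ᶠ y in l, 0 ≤ a * y + b) ∨ (∀ᶠ y in l, a * y + b ≤ 0)

theorem AffineGerm.congr {l : Filter ℝ} {f g : ℝ → ℝ} (hf : AffineGerm l f)
    (h : ∀ᶠ y in l, g y = f y) : AffineGerm l g := by
  obtain ⟨a, b, hab⟩ := hf
  refine ⟨a, b, ?_⟩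
  filter_upwards [hab, h] with y h1 h2
  rw [h2, h1]

/-- The difference of two affine maps has constant sign along `l`, so the maximum is eventually one
of the two. This closes `PL` and `PLF` under envelopes. -/
theorem AffineGerm.max {l : Filter ℝ} (hl : SignFilter l) {f g : ℝ → ℝ} (hf : AffineGerm l f)
    (hg : AffineGerm l g) : AffineGerm l fun x => max (f x) (g x) := by
  obtain ⟨a, b, hab⟩ := id hf
  obtain ⟨c, d, hcd⟩ := id hg
  rcases hl (a - c) (b - d) with h | h
  · refine hf.congr ?_
    filter_upwards [h, hab, hcd] with y h1 h2 h3
    exact max_eq_left (by linarith)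
  · refine hg.congr ?_
    filter_upwards [h, hab, hcd] with y h1 h2 h3
    exact max_eq_right (by linarith)

theorem AffineGerm.min {l : Filter ℝ} (hl : SignFilter l) {f g : ℝ → ℝ} (hf : AffineGerm l f)
    (hg : AffineGerm l g) : AffineGerm l fun x => min (f x) (g x) := by
  obtain ⟨a, b, hab⟩ := id hf
  obtain ⟨c, d, hcd⟩ := id hg
  rcases hl (a - c) (b - d) with h | h
  · refine hg.congr ?_
    filter_upwards [h, hab, hcd] with y h1 h2 h3
    exact min_eq_right (by linarith)
  · refine hf.congr ?_
    filter_upwards [h, hab, hcd] with y h1 h2 h3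
    exact min_eq_left (by linarith)

theorem affineGerm_affine (l : Filter ℝ) (a b : ℝ) : AffineGerm l fun x => a * x + b :=
  ⟨a, b, Eventually.of_forall fun _ => rfl⟩

theorem signFilter_nhdsGT (x : ℝ) : SignFilter (𝓝[>] x) := by
  intro a b
  have hc : ContinuousAt (fun y : ℝ => a * y + b) x := by fun_prop
  rcases lt_trichotomy (a * x + b) 0 with h | h | h
  · exact Or.inr (nhdsWithin_le_nhds ((hc.eventually_lt_const h).mono fun _ => le_of_lt))
  · rcases le_total 0 a with ha | ha
    · left
      filter_upwards [self_mem_nhdsWithin] with y hy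
      have := mul_le_mul_of_nonneg_left (le_of_lt hy : x ≤ y) ha
      linarith
    · right
      filter_upwards [self_mem_nhdsWithin] with y hy
      have := mul_le_mul_of_nonpos_left (le_of_lt hy : x ≤ y) ha
      linarith
  · exact Or.inl (nhdsWithin_le_nhds ((hc.eventually_const_lt h).mono fun _ => le_of_lt))

theorem signFilter_atTop : SignFilter atTop := by
  intro a b
  rcases lt_trichotomy a 0 with h | rfl | h
  · right
    filter_upwards [eventually_ge_atTop (-b / a)] with y hy
    rw [div_le_iff_of_neg h] at hy
    linarith
  · rcases le_total 0 b with hb | hb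
    · exact Or.inl (Eventually.of_forall fun y => by linarith)
    · exact Or.inr (Eventually.of_forall fun y => by linarith)
  · left
    filter_upwards [eventually_ge_atTop (-b / a)] with y hy
    rw [div_le_iff₀ h] at hy
    linarith

theorem SignFilter.neg {l m : Filter ℝ} (hl : SignFilter l) (h : Tendsto Neg.neg m l) :
    SignFilter m := by
  intro a b
  rcases hl (-a) b with h' | h'
  · left
    filter_upwards [h.eventually h'] with y hy
    linarith
  · right
    filter_upwards [h.eventually h'] with y hy
    linarith

theorem signFilter_nhdsLT (x : ℝ) : SignFilter (𝓝[<] x) :=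
  (signFilter_nhdsGT (-x)).neg (tendsto_neg_nhdsLT (a := x))

theorem signFilter_atBot : SignFilter atBot :=
  signFilter_atTop.neg tendsto_neg_atBot_atTop

/-! ### Characterisation of `PL` and `PLF` by germs -/

/-- The derivative is locally constant, hence constant on a connected open set, and then so is `f y
- a * y`. -/
theorem exists_affine_of_locallyAffineAt {f : ℝ → ℝ} {s : Set ℝ} (hs : IsOpen s)
    (hs' : IsPreconnected s) (h : ∀ x ∈ s, LocallyAffineAt f x) :
    ∃ a b : ℝ, ∀ x ∈ s, f x = a * x + b := by
  have key : ∀ x ∈ s, ∃ a : ℝ, ∀ᶠ y in 𝓝 x, HasDerivAt f a y := by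
    intro x hx
    obtain ⟨a, b, hab⟩ := h x hx
    refine ⟨a, ?_⟩
    filter_upwards [hab.eventually_nhds] with y hy
    refine HasDerivAt.congr_of_eventuallyEq ?_ hy
    simpa using ((hasDerivAt_id y).const_mul a).add_const b
  have key2 : ∀ x ∈ s, HasDerivAt (deriv f) 0 x := by
    intro x hx
    obtain ⟨a, ha⟩ := key x hx
    exact (hasDerivAt_const x a).congr_of_eventuallyEq (ha.mono fun y hy => hy.deriv)
  obtain ⟨a, ha⟩ := hs.exists_is_const_of_deriv_eq_zero hs'
    (fun x hx => (key2 x hx).differentiableAt.differentiableWithinAt)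
    (fun x hx => (key2 x hx).deriv)
  have key3 : ∀ x ∈ s, HasDerivAt (fun y => f y - a * y) 0 x := by
    intro x hx
    obtain ⟨c, hc⟩ := key x hx
    have h1 := hc.self_of_nhds
    have h2 : c = a := by rw [← ha x hx, h1.deriv]
    subst h2
    have h2 := h1.sub ((hasDerivAt_id x).const_mul c)
    rw [mul_one, sub_self] at h2
    exact h2
  obtain ⟨b, hb⟩ := hs.exists_is_const_of_deriv_eq_zero hs'
    (fun x hx => (key3 x hx).differentiableAt.differentiableWithinAt)
    (fun x hx => (key3 x hx).deriv)
  exact ⟨a, b, fun x hx => by linarith [hb x hx]⟩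

/-- The map `f` is affine on one-sided neighbourhoods of every point. -/
def PiecewiseAffine (f : ℝ → ℝ) : Prop :=
  ∀ x, AffineGerm (𝓝[>] x) f ∧ AffineGerm (𝓝[<] x) f

/-- The break set is always closed, so its discreteness means that every point has a punctured
neighbourhood without breaks; each half of it carries one affine map. -/
theorem mem_PL_iff {f : H} : f ∈ PL ↔ PiecewiseAffine f := by
  constructor
  · intro hf x
    have h := (isClosed_and_discrete_iff.mp ⟨isClosed_breakSet f, hf⟩) x
    rw [disjoint_principal_right] at h
    obtain ⟨ε, hε, hb⟩ := Metric.mem_nhdsWithin_iff.mp h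
    have hb' : ∀ y, y ≠ x → |y - x| < ε → LocallyAffineAt f y := fun y hy hyx =>
      not_not.mp (hb ⟨by rwa [Metric.mem_ball, Real.dist_eq], hy⟩)
    constructor
    · obtain ⟨a, b, hab⟩ := exists_affine_of_locallyAffineAt (f := f) (isOpen_Ioo (a := x)
        (b := x + ε)) isPreconnected_Ioo fun y hy => hb' y hy.1.ne' <| by
          rw [abs_lt]; constructor <;> linarith [hy.1, hy.2]
      exact ⟨a, b, by filter_upwards [Ioo_mem_nhdsGT (by linarith : x < x + ε)] using hab⟩
    · obtain ⟨a, b, hab⟩ := exists_affine_of_locallyAffineAt (f := f) (isOpen_Ioo (a := x - ε)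
        (b := x)) isPreconnected_Ioo fun y hy => hb' y hy.2.ne <| by
          rw [abs_lt]; constructor <;> linarith [hy.1, hy.2]
      exact ⟨a, b, by filter_upwards [Ioo_mem_nhdsLT (by linarith : x - ε < x)] using hab⟩
  · intro hf
    refine (isClosed_and_discrete_iff.mpr fun x => ?_).2
    rw [disjoint_principal_right, ← nhdsLT_sup_nhdsGT, mem_sup]
    obtain ⟨⟨a, b, hab⟩, c, d, hcd⟩ := hf x
    constructor
    · filter_upwards [eventually_eventually_nhdsWithin.mpr hcd, self_mem_nhdsWithin] with y hy hyx
      refine not_not.mpr ⟨c, d, ?_⟩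
      rwa [nhdsWithin_eq_nhds.mpr (isOpen_Iio.mem_nhds hyx)] at hy
    · filter_upwards [eventually_eventually_nhdsWithin.mpr hab, self_mem_nhdsWithin] with y hy hyx
      refine not_not.mpr ⟨a, b, ?_⟩
      rwa [nhdsWithin_eq_nhds.mpr (isOpen_Ioi.mem_nhds hyx)] at hy

/-- Affine germs at both infinities confine the breaks to a compact interval, where a closed
discrete set is finite. -/
theorem mem_PLF_iff {f : H} :
    f ∈ PLF ↔ PiecewiseAffine f ∧ AffineGerm atTop f ∧ AffineGerm atBot f := by
  constructor
  · intro hf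
    have hf' : (breakSet f).Finite := hf
    refine ⟨mem_PL_iff.mp (hf'.isDiscrete : IsDiscrete (breakSet f)), ?_, ?_⟩
    · obtain ⟨M, hM⟩ := hf'.bddAbove
      obtain ⟨a, b, hab⟩ := exists_affine_of_locallyAffineAt (f := f) (isOpen_Ioi (a := M))
        isPreconnected_Ioi fun y hy => by
          by_contra h
          exact absurd (hM h) (not_le.mpr hy)
      exact ⟨a, b, by filter_upwards [eventually_gt_atTop M] using hab⟩
    · obtain ⟨M, hM⟩ := hf'.bddBelow
      obtain ⟨a, b, hab⟩ := exists_affine_of_locallyAffineAt (f := f) (isOpen_Iio (a := M))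
        isPreconnected_Iio fun y hy => by
          by_contra h
          exact absurd (hM h) (not_le.mpr hy)
      exact ⟨a, b, by filter_upwards [eventually_lt_atBot M] using hab⟩
  · rintro ⟨hf, ⟨a, b, hab⟩, c, d, hcd⟩
    obtain ⟨M, hM⟩ := eventually_atTop.mp hab
    obtain ⟨m, hm⟩ := eventually_atBot.mp hcd
    have hd : IsDiscrete (breakSet f) := mem_PL_iff.mpr hf
    have hsub : breakSet f ⊆ Set.Icc m M := by
      intro x hx
      constructor
      · by_contra hxm
        refine hx ⟨c, d, ?_⟩
        filter_upwards [isOpen_Iio.mem_nhds (not_le.mp hxm)] with y hy using hm y (le_of_lt hy)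
      · by_contra hxm
        refine hx ⟨a, b, ?_⟩
        filter_upwards [isOpen_Ioi.mem_nhds (not_le.mp hxm)] with y hy using hM y (le_of_lt hy)
    exact (isCompact_Icc.of_isClosed_subset (isClosed_breakSet f) hsub).finite hd

theorem PiecewiseAffine.max {f g : ℝ → ℝ} (hf : PiecewiseAffine f) (hg : PiecewiseAffine g) :
    PiecewiseAffine fun x => max (f x) (g x) := fun x =>
  ⟨(hf x).1.max (signFilter_nhdsGT x) (hg x).1, (hf x).2.max (signFilter_nhdsLT x) (hg x).2⟩

theorem PiecewiseAffine.min {f g : ℝ → ℝ} (hf : PiecewiseAffine f) (hg : PiecewiseAffine g) :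
    PiecewiseAffine fun x => min (f x) (g x) := fun x =>
  ⟨(hf x).1.min (signFilter_nhdsGT x) (hg x).1, (hf x).2.min (signFilter_nhdsLT x) (hg x).2⟩

theorem piecewiseAffine_affine (a b : ℝ) : PiecewiseAffine fun x => a * x + b :=
  fun _ => ⟨affineGerm_affine _ a b, affineGerm_affine _ a b⟩

/-! ### Homeomorphisms of the line -/

theorem mul_apply (f g : H) (x : ℝ) : (f * g) x = f (g x) := rfl

theorem one_apply (x : ℝ) : (1 : H) x = x := rfl

theorem inv_apply_self (f : H) (x : ℝ) : (f⁻¹ : H) (f x) = x := f.symm_apply_apply x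

theorem apply_inv_self (f : H) (x : ℝ) : f ((f⁻¹ : H) x) = x := f.apply_symm_apply x

/-- The homeomorphism given by a strictly increasing surjection. -/
noncomputable def ofStrictMono (f : ℝ → ℝ) (hf : StrictMono f) (hs : f.Surjective) : H :=
  (hf.orderIsoOfSurjective f hs).toHomeomorph

theorem ofStrictMono_mem_HPlus (f : ℝ → ℝ) (hf : StrictMono f) (hs : f.Surjective) :
    ofStrictMono f hf hs ∈ HPlus := hf

theorem strictMono_or_strictAnti (f : H) : StrictMono f ∨ StrictAnti f :=
  f.continuous.strictMono_of_inj f.injective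

/-- The homeomorphism `x ↦ a * x + b`. -/
noncomputable def affine (a b : ℝ) (ha : a ≠ 0) : H :=
  (Homeomorph.mulLeft₀ a ha).trans (Homeomorph.addRight b)

theorem affine_apply (a b : ℝ) (ha : a ≠ 0) (x : ℝ) : affine a b ha x = a * x + b := rfl

theorem affine_mem_PL (a b : ℝ) (ha : a ≠ 0) : affine a b ha ∈ PL :=
  mem_PL_iff.mpr (piecewiseAffine_affine a b)

theorem affine_mem_PLPlus (a b : ℝ) (ha : 0 < a) : affine a b ha.ne' ∈ PLPlus := by
  refine ⟨affine_mem_PL a b _, fun x y hxy => ?_⟩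
  simp only [affine_apply]
  have := mul_lt_mul_of_pos_left hxy ha
  linarith

/-- Translation by `b`. -/
def translation (b : ℝ) : H := Homeomorph.addRight b

theorem translation_apply (b x : ℝ) : translation b x = x + b := rfl

theorem translation_mem_PLPlus (b : ℝ) : translation b ∈ PLPlus := by
  refine ⟨mem_PL_iff.mpr ?_, fun x y hxy => ?_⟩
  · convert piecewiseAffine_affine 1 b using 2 with x
    rw [translation_apply, one_mul]
  · simpa [translation_apply] using hxy

theorem exists_sup {f g : H} (hf : f ∈ HPlus) (hg : g ∈ HPlus) :
    ∃ k ∈ HPlus, (∀ x, k x = max (f x) (g x)) ∧ (f ∈ PL → g ∈ PL → k ∈ PL) := by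
  have hf' : StrictMono f := hf
  have hg' : StrictMono g := hg
  have hm : StrictMono fun x => max (f x) (g x) := fun x y hxy =>
    max_lt_max (hf' hxy) (hg' hxy)
  refine ⟨ofStrictMono _ hm fun y => ?_, hm, fun x => rfl, fun h1 h2 =>
    mem_PL_iff.mpr ((mem_PL_iff.mp h1).max (mem_PL_iff.mp h2))⟩
  rcases le_total ((f⁻¹ : H) y) ((g⁻¹ : H) y) with h | h
  · refine ⟨(f⁻¹ : H) y, ?_⟩
    have := hg'.monotone h
    rw [apply_inv_self] at this
    exact (congrArg (max · _) (apply_inv_self f y)).trans (max_eq_left this)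
  · refine ⟨(g⁻¹ : H) y, ?_⟩
    have := hf'.monotone h
    rw [apply_inv_self] at this
    exact (congrArg (max _ ·) (apply_inv_self g y)).trans (max_eq_right this)

theorem exists_inf {f g : H} (hf : f ∈ HPlus) (hg : g ∈ HPlus) :
    ∃ k ∈ HPlus, (∀ x, k x = min (f x) (g x)) ∧ (f ∈ PL → g ∈ PL → k ∈ PL) := by
  have hf' : StrictMono f := hf
  have hg' : StrictMono g := hg
  have hm : StrictMono fun x => min (f x) (g x) := fun x y hxy =>
    min_lt_min (hf' hxy) (hg' hxy)
  refine ⟨ofStrictMono _ hm fun y => ?_, hm, fun x => rfl, fun h1 h2 =>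
    mem_PL_iff.mpr ((mem_PL_iff.mp h1).min (mem_PL_iff.mp h2))⟩
  rcases le_total ((f⁻¹ : H) y) ((g⁻¹ : H) y) with h | h
  · refine ⟨(g⁻¹ : H) y, ?_⟩
    have := hf'.monotone h
    rw [apply_inv_self] at this
    exact (congrArg (min _ ·) (apply_inv_self g y)).trans (min_eq_right this)
  · refine ⟨(f⁻¹ : H) y, ?_⟩
    have := hg'.monotone h
    rw [apply_inv_self] at this
    exact (congrArg (min · _) (apply_inv_self f y)).trans (min_eq_left this)

/-- The pointwise maximum of a decreasing homeomorphism and its inverse is an involution. -/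
theorem exists_involution_sup_inv {f : H} (hf : StrictAnti f) :
    ∃ k : H, k * k = 1 ∧ StrictAnti k ∧ (∀ x, k x = max (f x) ((f⁻¹ : H) x)) ∧
      (f ∈ PL → k ∈ PL) ∧ (f ∈ PLF → k ∈ PLF) := by
  have hf' : StrictAnti (f⁻¹ : H) := fun x y hxy => by
    rw [← apply_inv_self f x, ← apply_inv_self f y] at hxy
    exact hf.lt_iff_gt.mp hxy
  -- The graphs of `f` and `f⁻¹` are mirror images in the diagonal; for decreasing maps their upper
  -- envelope is symmetric too.
  have hinv : ∀ x, max (f (max (f x) ((f⁻¹ : H) x))) ((f⁻¹ : H) (max (f x) ((f⁻¹ : H) x))) = x := by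
    intro x
    rcases le_total (f x) ((f⁻¹ : H) x) with h | h
    · have := hf'.antitone h
      rw [inv_apply_self] at this
      rw [max_eq_right h, apply_inv_self, max_eq_left this]
    · have := hf.antitone h
      rw [apply_inv_self] at this
      rw [max_eq_left h, inv_apply_self, max_eq_right this]
  have hcont : Continuous fun x => max (f x) ((f⁻¹ : H) x) :=
    f.continuous.max (f⁻¹ : H).continuous
  refine ⟨⟨⟨fun x => max (f x) ((f⁻¹ : H) x), fun x => max (f x) ((f⁻¹ : H) x), hinv, hinv⟩,
    hcont, hcont⟩, Homeomorph.ext hinv, fun x y hxy =>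
    max_lt_max (hf hxy) (hf' hxy), fun x => rfl, fun h => ?_, fun h => ?_⟩
  · exact mem_PL_iff.mpr ((mem_PL_iff.mp h).max (mem_PL_iff.mp (PL.inv_mem h)))
  · have h1 := mem_PLF_iff.mp h
    have h2 := mem_PLF_iff.mp (PLF.inv_mem h)
    exact mem_PLF_iff.mpr ⟨h1.1.max h2.1, h1.2.1.max signFilter_atTop h2.2.1,
      h1.2.2.max signFilter_atBot h2.2.2⟩

/-! ### Products of reversible elements in a group -/

section Group

variable {G : Type*} [Group G]

theorem mul_mem_R {m n : ℕ} {a b : G} (ha : a ∈ R m G) (hb : b ∈ R n G) : a * b ∈ R (m + n) G := by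
  obtain ⟨l, hl, hl', rfl⟩ := ha
  obtain ⟨k, hk, hk', rfl⟩ := hb
  refine ⟨l ++ k, by simp [hl, hk], fun t ht => ?_, List.prod_append⟩
  exact (List.mem_append.mp ht).elim (hl' t) (hk' t)

theorem mem_R_one {a : G} (ha : IsReversible a) : a ∈ R 1 G :=
  ⟨[a], rfl, by simpa using ha, by simp⟩

theorem map_mem_R {G' : Type*} [Group G'] (φ : G →* G') {n : ℕ} {a : G} (ha : a ∈ R n G) :
    φ a ∈ R n G' := by
  obtain ⟨l, hl, hl', rfl⟩ := ha
  refine ⟨l.map φ, by simp [hl], fun t ht => ?_, (map_list_prod φ l).symm⟩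
  obtain ⟨s, hs, rfl⟩ := List.mem_map.mp ht
  obtain ⟨h, hh⟩ := hl' s hs
  exact ⟨φ h, by rw [← map_inv, ← map_mul, ← map_mul, hh, map_inv]⟩

theorem conj_mem_R {n : ℕ} {a : G} (ha : a ∈ R n G) (h : G) : h * a * h⁻¹ ∈ R n G :=
  map_mem_R (MulAut.conj h).toMonoidHom ha

theorem IsReversible.inv {a : G} (ha : IsReversible a) : IsReversible a⁻¹ := by
  obtain ⟨h, hh⟩ := ha
  exact ⟨h, by rw [← conj_inv, hh]⟩

theorem inv_mem_R {n : ℕ} {a : G} (ha : a ∈ R n G) : a⁻¹ ∈ R n G := by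
  obtain ⟨l, hl, hl', rfl⟩ := ha
  refine ⟨(l.map fun x => x⁻¹).reverse, by simp [hl], fun t ht => ?_,
    (List.prod_inv_reverse l).symm⟩
  obtain ⟨s, hs, rfl⟩ := List.mem_map.mp (List.mem_reverse.mp ht)
  exact (hl' s hs).inv

theorem IsInvolution.isReversible_mul {s t : G} (hs : IsInvolution s) (ht : IsInvolution t) :
    IsReversible (s * t) := by
  have hs' : s * s = 1 := by rw [← sq]; exact hs
  have ht' : t * t = 1 := by rw [← sq]; exact ht
  have h1 : s⁻¹ = s := inv_eq_of_mul_eq_one_left hs'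
  have h2 : t⁻¹ = t := inv_eq_of_mul_eq_one_left ht'
  refine ⟨s, ?_⟩
  rw [mul_inv_rev, h1, h2, ← mul_assoc s s t, hs', one_mul]

/-- If every reversible element is a product of two involutions, then `I (2 * n) = R n`. -/
theorem I_two_mul_eq_R (hG : ∀ g : G, IsReversible g →
    ∃ s t : G, IsInvolution s ∧ IsInvolution t ∧ s * t = g) (n : ℕ) : I (2 * n) G = R n G := by
  induction n with
  | zero =>
    ext g
    constructor <;> rintro ⟨l, hl, -, rfl⟩ <;>
      rw [List.eq_nil_of_length_eq_zero hl] <;> exact ⟨[], rfl, by simp, rfl⟩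
  | succ n ih =>
    ext g
    constructor
    · rintro ⟨l, hl, hl', rfl⟩
      match l, hl with
      | s :: t :: k, hl =>
        have hk : k.prod ∈ R n G := by
          rw [← ih]
          refine ⟨k, by simp at hl; omega, fun x hx => hl' x (by simp [hx]), rfl⟩
        have := mul_mem_R (mem_R_one ((hl' s (by simp)).isReversible_mul (hl' t (by simp)))) hk
        rwa [List.prod_cons, List.prod_cons, ← mul_assoc, add_comm]
      | [x], hl => simp at hl; omega
    · rintro ⟨l, hl, hl', rfl⟩
      match l, hl with
      | g :: k, hl =>
        have hk : k.prod ∈ I (2 * n) G := by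
          rw [ih]
          exact ⟨k, by simpa using hl, fun x hx => hl' x (by simp [hx]), rfl⟩
        obtain ⟨m, hm, hm', hmk⟩ := hk
        obtain ⟨s, t, hs, ht, rfl⟩ := hG g (hl' g (by simp))
        refine ⟨s :: t :: m, by simp; omega, fun x hx => ?_, by simp [hmk, mul_assoc]⟩
        rcases List.mem_cons.mp hx with rfl | hx
        · exact hs
        rcases List.mem_cons.mp hx with rfl | hx
        · exact ht
        · exact hm' x hx

end Group

/-! ### Reversibility in `PLF` -/

theorem eq_zero_of_eventually_affine {l : Filter ℝ} [l.NeBot] (hl : ∀ x, ∀ᶠ y in l, y ≠ x)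
    {a b : ℝ} (h : ∀ᶠ y in l, a * y + b = 0) : a = 0 ∧ b = 0 := by
  obtain ⟨x, hx⟩ := h.exists
  obtain ⟨y, hy, hyx⟩ := (h.and (hl x)).exists
  have ha : a = 0 := by
    have : a * (y - x) = 0 := by linarith
    exact (mul_eq_zero.mp this).resolve_right (sub_ne_zero.mpr hyx)
  subst ha
  exact ⟨rfl, by linarith⟩

theorem slope_pos_of_strictMono {l : Filter ℝ} [l.NeBot] (hl : ∀ x, ∀ᶠ y in l, y ≠ x)
    {f : ℝ → ℝ} (hf : StrictMono f) {a b : ℝ} (h : ∀ᶠ y in l, f y = a * y + b) : 0 < a := by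
  obtain ⟨x, hx⟩ := h.exists
  obtain ⟨y, hy, hyx⟩ := (h.and (hl x)).exists
  by_contra! ha
  rcases lt_or_gt_of_ne hyx with h1 | h1
  · have := hf h1
    nlinarith
  · have := hf h1
    nlinarith

/-- An increasing map with an affine germ, conjugate to its inverse through such a map, has the
germ of the identity. -/
theorem eventually_eq_self_of_reversed {l : Filter ℝ} [l.NeBot] (hl : ∀ x, ∀ᶠ y in l, y ≠ x)
    {g h : ℝ → ℝ} (hg : StrictMono g) (hh : StrictMono h) (hgl : Tendsto g l l)
    (hhl : Tendsto h l l) (ag : AffineGerm l g) (ah : AffineGerm l h)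
    (hgh : ∀ x, g (h (g x)) = h x) : ∀ᶠ x in l, g x = x := by
  obtain ⟨a, b, hab⟩ := ag
  obtain ⟨c, d, hcd⟩ := ah
  have ha := slope_pos_of_strictMono hl hg hab
  have hc := slope_pos_of_strictMono hl hh hcd
  -- Coefficients of `g ∘ h ∘ g = h`: the slopes give `a ^ 2 = 1`, so `a = 1` by positivity, and the
  -- constants then give `(c + 1) * b = 0`.
  have key : ∀ᶠ x in l, (a * c * a - c) * x + (a * (c * b + d) + b - d) = 0 := by
    filter_upwards [hab, hcd, hgl.eventually hcd, (hhl.comp hgl).eventually hab] with x h1 h2 h3 h4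
    have := hgh x
    rw [Function.comp_apply] at h4
    rw [h4, h3, h2, h1] at this
    linarith
  obtain ⟨k1, k2⟩ := eq_zero_of_eventually_affine hl key
  have ha1 : a = 1 := by
    have h0 : c * (a + 1) * (a - 1) = 0 := by linarith
    have h1 : c * (a + 1) ≠ 0 := by positivity
    linarith [(mul_eq_zero.mp h0).resolve_left h1]
  subst ha1
  have hb : b = 0 := by
    have h0 : (c + 1) * b = 0 := by linarith
    exact (mul_eq_zero.mp h0).resolve_left (by positivity)
  filter_upwards [hab] with x hx
  rw [hx, hb]
  ring

theorem tendsto_atTop_of_strictMono (f : H) (hf : StrictMono f) : Tendsto f atTop atTop :=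
  (hf.orderIsoOfSurjective f f.surjective).tendsto_atTop

theorem tendsto_nhdsLT_of_strictMono (f : H) (hf : StrictMono f) {p : ℝ} (hp : f p = p) :
    Tendsto f (𝓝[<] p) (𝓝[<] p) := by
  refine tendsto_nhdsWithin_iff.mpr ⟨?_, ?_⟩
  · have := f.continuous.tendsto p
    rw [hp] at this
    exact this.mono_left nhdsWithin_le_nhds
  · filter_upwards [self_mem_nhdsWithin] with y hy
    have := hf hy
    rwa [hp] at this

/-- The germ argument at `+∞` bounds the non-fixed points of `g` above. Their supremum is fixed by
both maps, and the same argument on its left contradicts its being a supremum. -/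
theorem eq_one_of_reversed_PLF {g h : H} (hg : g ∈ PLF) (hh : h ∈ PLF) (hg' : StrictMono g)
    (hh' : StrictMono h) (hgh : h * g * h⁻¹ = g⁻¹) : g = 1 := by
  have hfun : ∀ x, g (h (g x)) = h x := by
    have : g * (h * g) = h := by
      have : h * g = g⁻¹ * h := by rw [← hgh]; group
      rw [this, mul_inv_cancel_left]
    exact fun x => DFunLike.congr_fun this x
  have hne : ∀ p x : ℝ, ∀ᶠ y in 𝓝[<] p, y ≠ x := fun p x => by
    rcases eq_or_ne p x with rfl | hpx
    · filter_upwards [self_mem_nhdsWithin] with y hy using ne_of_lt hy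
    · exact nhdsWithin_le_nhds (eventually_ne_nhds hpx)
  obtain ⟨pg, tg, -⟩ := mem_PLF_iff.mp hg
  obtain ⟨ph, th, -⟩ := mem_PLF_iff.mp hh
  have htop : ∀ᶠ x in atTop, g x = x :=
    eventually_eq_self_of_reversed (fun x => eventually_ne_atTop x) hg' hh'
      (tendsto_atTop_of_strictMono g hg') (tendsto_atTop_of_strictMono h hh') tg th hfun
  by_contra hg1
  set S : Set ℝ := {x | g x ≠ x} with hS
  have hSne : S.Nonempty := by
    by_contra hn
    refine hg1 (Homeomorph.ext fun x => ?_)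
    by_contra hx
    exact hn ⟨x, hx⟩
  have hSb : BddAbove S := by
    obtain ⟨M, hM⟩ := eventually_atTop.mp htop
    refine ⟨M, fun x hx => ?_⟩
    by_contra! hlt
    exact hx (hM x hlt.le)
  have hlub := isLUB_csSup hSne hSb
  set p := sSup S
  have hSo : IsOpen S := (isClosed_eq g.continuous continuous_id).isOpen_compl
  have hpS : p ∉ S := by
    intro hp
    obtain ⟨ε, hε, hb⟩ := Metric.isOpen_iff.mp hSo p hp
    have : p + ε / 2 ∈ S := hb (by simp [abs_of_pos hε]; linarith)
    linarith [hlub.1 this]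
  have hgp : g p = p := not_not.mp hpS
  have hmem : ∀ x, h x ∈ S ↔ x ∈ S := by
    intro x
    refine not_congr ⟨fun hx => ?_, fun hx => ?_⟩
    · have h1 := hfun x
      rw [← hx] at h1
      exact h.injective (g.injective (h1.trans (congrArg g hx.symm)) |>.trans (by rw [hx]))
    · have := hfun x
      rwa [hx] at this
  -- An increasing bijection that preserves `S` fixes its least upper bound.
  have hhp : h p = p := by
    refine IsLUB.unique (s := S) ⟨fun x hx => ?_, fun y hy => ?_⟩ hlub
    · rw [← apply_inv_self h x] at hx ⊢
      exact hh'.monotone (hlub.1 ((hmem _).mp hx))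
    · rw [← apply_inv_self h y]
      refine hh'.monotone (hlub.2 fun x hx => ?_)
      rw [← hh'.le_iff_le, apply_inv_self]
      exact hy ((hmem x).mpr hx)
  have hleft := eventually_eq_self_of_reversed (hne p) hg' hh'
    (tendsto_nhdsLT_of_strictMono g hg' hgp) (tendsto_nhdsLT_of_strictMono h hh' hhp)
    (pg p).2 (ph p).2 hfun
  obtain ⟨m, hm, hmp⟩ := (mem_nhdsLT_iff_exists_Ioo_subset).mp hleft
  obtain ⟨x, hx, hmx, hxp⟩ := hlub.exists_between hm
  have hxp' : x < p := lt_of_le_of_ne hxp fun h => hpS (h ▸ hx)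
  exact hx (hmp ⟨hmx, hxp'⟩)

theorem mul_strictAnti {f g : H} (hf : StrictAnti f) (hg : StrictAnti g) : StrictMono (f * g : H) :=
  hf.comp hg

/-- An increasing homeomorphism reversed by a decreasing one is reversed by a decreasing
involution. -/
theorem exists_involution_of_reversed {g h : H} (hg : StrictMono g) (hh : StrictAnti h)
    (hgh : h * g * h⁻¹ = g⁻¹) : ∃ k : H, k * k = 1 ∧ (k * g) * (k * g) = 1 ∧
      (h ∈ PLF → k ∈ PLF) := by
  obtain ⟨k, hk, -, hkx, -, hkm⟩ := exists_involution_sup_inv hh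
  have h1 : ∀ x, g (h (g x)) = h x := by
    have : g * (h * g) = h := by
      have : h * g = g⁻¹ * h := by rw [← hgh]; group
      rw [this, mul_inv_cancel_left]
    exact fun x => DFunLike.congr_fun this x
  have h2 : ∀ x, g ((h⁻¹ : H) (g x)) = (h⁻¹ : H) x := by
    have : g * (h⁻¹ * g) = h⁻¹ := by
      have h3 : h * g⁻¹ * h⁻¹ = g := by
        rw [← conj_inv, hgh, inv_inv]
      calc g * (h⁻¹ * g) = h * g⁻¹ * h⁻¹ * (h⁻¹ * g) := by rw [h3]
        _ = h⁻¹ := by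
          have h4 : h * g = g⁻¹ * h := by rw [← hgh]; group
          have h5 : h * g⁻¹ = g * h := by nth_rw 2 [← h3]; group
          have h6 : h⁻¹ * g = g⁻¹ * h⁻¹ := by
            rw [inv_mul_eq_iff_eq_mul, ← mul_assoc, h5]; group
          rw [h3, h6, mul_inv_cancel_left]
    exact fun x => DFunLike.congr_fun this x
  refine ⟨k, hk, ?_, hkm⟩
  -- Both `h` and `h⁻¹` solve `g ∘ y ∘ g = y`, and the increasing `g` commutes with maxima.
  have h3 : g * (k * g) = k := Homeomorph.ext fun x => by
    simp only [mul_apply, hkx]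
    rw [hg.monotone.map_max, h1, h2]
  rw [mul_assoc, h3, hk]

theorem isReversible_PLF_eq_mul (g : PLF) (hg : IsReversible g) :
    ∃ s t : PLF, IsInvolution s ∧ IsInvolution t ∧ s * t = g := by
  obtain ⟨h, hh⟩ := hg
  have hgh : (h * g * h⁻¹ : H) = (g : H)⁻¹ := by exact_mod_cast congrArg Subtype.val hh
  rcases strictMono_or_strictAnti (g : H) with hgm | hga
  · rcases strictMono_or_strictAnti (h : H) with hhm | hha
    · have h1 : g = 1 := Subtype.ext (eq_one_of_reversed_PLF g.2 h.2 hgm hhm hgh)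
      exact ⟨1, 1, one_pow 2, one_pow 2, by rw [h1, one_mul]⟩
    · obtain ⟨k, hk, hkg, hkm⟩ := exists_involution_of_reversed hgm hha hgh
      refine ⟨⟨k, hkm h.2⟩, ⟨k, hkm h.2⟩ * g, Subtype.ext ?_, Subtype.ext ?_, Subtype.ext ?_⟩
      · simpa [sq] using hk
      · simpa [sq] using hkg
      · change k * (k * g) = g
        rw [← mul_assoc, hk, one_mul]
  -- For decreasing `g` the rigidity applies to the increasing `g * g`. One of `h` and `h * g` is
  -- increasing, and both reverse `g`.
  · have key : ∀ h' : PLF, StrictMono (h' : H) → h' * g * h'⁻¹ = g⁻¹ →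
        ∃ s t : PLF, IsInvolution s ∧ IsInvolution t ∧ s * t = g := by
      intro h' hm hh'
      have h2 : h' * (g * g) * h'⁻¹ = (g * g)⁻¹ := by
        rw [mul_inv_rev, ← hh']; group
      have h3 : g * g = 1 := Subtype.ext (eq_one_of_reversed_PLF (g * g).2 h'.2
        (mul_strictAnti hga hga) hm (by exact_mod_cast congrArg Subtype.val h2))
      exact ⟨g, 1, by rw [IsInvolution, sq, h3], one_pow 2, mul_one g⟩
    rcases strictMono_or_strictAnti (h : H) with hhm | hha
    · exact key h hhm hh
    · exact key (h * g) (mul_strictAnti hha hga) (by rw [← hh]; group)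

theorem R_PLFPlus (n : ℕ) : R n PLFPlus = {1} := by
  have key : ∀ g : PLFPlus, IsReversible g → g = 1 := by
    rintro g ⟨h, hh⟩
    exact Subtype.ext (eq_one_of_reversed_PLF g.2.1 h.2.1 g.2.2 h.2.2
      (by exact_mod_cast congrArg Subtype.val hh))
  ext g
  constructor
  · rintro ⟨l, -, hl', rfl⟩
    exact List.prod_eq_one fun x hx => key x (hl' x hx)
  · rintro rfl
    refine ⟨List.replicate n 1, by simp, fun t ht => ?_, by simp⟩
    rw [List.eq_of_mem_replicate ht]
    exact ⟨1, by simp⟩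

/-! ### Extending a map from a fundamental domain -/

/-- The map `θ` with `θ (s + 1) = f (θ s)` that agrees with `e` on `[0, 1)`. -/
noncomputable def equivariantExt (f e : H) (s : ℝ) : ℝ := (f ^ ⌊s⌋ : H) (e (Int.fract s))

section Ext

variable {f e : H}

theorem equivariantExt_add_one (s : ℝ) :
    equivariantExt f e (s + 1) = f (equivariantExt f e s) := by
  rw [equivariantExt, Int.floor_add_one, Int.fract_add_one, add_comm, zpow_one_add, mul_apply]
  rfl

theorem equivariantExt_eq (h : e 1 = f (e 0)) {n : ℤ} {s : ℝ} (hn : n ≤ s) (hn' : s ≤ n + 1) :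
    equivariantExt f e s = (f ^ n : H) (e (s - n)) := by
  rcases hn'.lt_or_eq with hlt | rfl
  · have : ⌊s⌋ = n := Int.floor_eq_iff.mpr ⟨hn, hlt⟩
    rw [equivariantExt, Int.fract, this]
  · rw [equivariantExt, Int.floor_add_one, Int.fract_add_one, Int.floor_intCast, Int.fract_intCast,
      zpow_add_one, mul_apply, add_sub_cancel_left, h]

theorem equivariantExt_strictMono (hf : f ∈ HPlus) (he : e ∈ HPlus) (h : e 1 = f (e 0)) :
    StrictMono (equivariantExt f e) := by
  have he' : StrictMono e := he
  have hpow : ∀ n : ℤ, StrictMono (f ^ n : H) := fun n => HPlus.zpow_mem hf n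
  have h0 : e 0 < f (e 0) := h ▸ he' one_pos
  have hseq : StrictMono fun n : ℤ => (f ^ n : H) (e 0) := by
    refine strictMono_int_of_lt_succ fun n => ?_
    change (f ^ n : H) (e 0) < (f ^ (n + 1) : H) (e 0)
    rw [zpow_add_one, mul_apply]
    exact hpow n h0
  intro s t hst
  rcases (Int.floor_le_floor hst.le).lt_or_eq with hlt | heq
  · calc equivariantExt f e s < (f ^ (⌊s⌋ + 1) : H) (e 0) := by
          rw [zpow_add_one, mul_apply, ← h]
          exact hpow _ (he' (Int.fract_lt_one s))
      _ ≤ (f ^ ⌊t⌋ : H) (e 0) := hseq.monotone hlt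
      _ ≤ equivariantExt f e t := (hpow _).monotone (he'.monotone (Int.fract_nonneg t))
  · rw [equivariantExt, equivariantExt, ← heq]
    refine hpow _ (he' ?_)
    rw [Int.fract, Int.fract, ← heq]
    linarith

theorem equivariantExt_int (h : e 1 = f (e 0)) (n : ℤ) :
    equivariantExt f e n = (f ^ n : H) (e 0) := by
  rw [equivariantExt_eq h le_rfl (by linarith), sub_self]

/-- Only points between two orbit points are claimed, so `f` may have fixed points elsewhere; the
orbit hulls below need this. -/
theorem exists_equivariantExt_eq (hf : f ∈ HPlus) (he : e ∈ HPlus) (h : e 1 = f (e 0)) {y : ℝ}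
    {m n : ℤ} (hm : (f ^ m : H) (e 0) ≤ y) (hn : y ≤ (f ^ n : H) (e 0)) :
    ∃ s, equivariantExt f e s = y := by
  have hpow : ∀ n : ℤ, StrictMono (f ^ n : H) := fun n => HPlus.zpow_mem hf n
  have hseq : StrictMono fun n : ℤ => (f ^ n : H) (e 0) := fun a b hab => by
    have := equivariantExt_strictMono hf he h (Int.cast_lt (R := ℝ).mpr hab)
    rwa [equivariantExt_int h, equivariantExt_int h] at this
  obtain ⟨k, hk, hk'⟩ := Int.exists_greatest_of_bdd (P := fun k => (f ^ k : H) (e 0) ≤ y)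
    ⟨n, fun z hz => hseq.le_iff_le.mp (hz.trans hn)⟩ ⟨m, hm⟩
  have hlt : y < (f ^ (k + 1) : H) (e 0) := by
    by_contra! hle
    linarith [hk' (k + 1) hle]
  obtain ⟨z, rfl⟩ := (f ^ k : H).surjective y
  rw [zpow_add_one, mul_apply, ← h] at hlt
  have h1 := (hpow k).le_iff_le.mp hk
  have h2 := (hpow k).lt_iff_lt.mp hlt
  obtain ⟨t, rfl⟩ := e.surjective z
  have he' : StrictMono e := he
  rw [he'.le_iff_le] at h1
  rw [he'.lt_iff_lt] at h2
  refine ⟨k + t, ?_⟩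
  rw [equivariantExt_eq h (by linarith) (by linarith), add_sub_cancel_left]

theorem equivariantExt_piecewiseAffine (hf : f ∈ PL) (he : e ∈ PL) (h : e 1 = f (e 0)) :
    PiecewiseAffine (equivariantExt f e) := by
  have key : ∀ n : ℤ, PiecewiseAffine (f ^ n * e * translation (-n) : H) := fun n =>
    mem_PL_iff.mp (PL.mul_mem (PL.mul_mem (PL.zpow_mem hf n) he) (translation_mem_PLPlus _).1)
  have heq : ∀ n : ℤ, ∀ y ∈ Set.Icc (n : ℝ) (n + 1),
      equivariantExt f e y = (f ^ n * e * translation (-n) : H) y := fun n y hy => by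
    rw [equivariantExt_eq h hy.1 hy.2, mul_apply, mul_apply, translation_apply, sub_eq_add_neg]
  intro x
  constructor
  · refine (key ⌊x⌋ x).1.congr ?_
    filter_upwards [Ioo_mem_nhdsGT (Int.lt_floor_add_one x)] with y hy
    exact heq _ y ⟨(Int.floor_le x).trans hy.1.le, hy.2.le⟩
  -- Unlike the floor, `⌈x⌉ - 1` indexes a cell containing a left neighbourhood of `x` even at an
  -- integer.
  · refine (key (⌈x⌉ - 1) x).2.congr ?_
    have hc := Int.ceil_lt_add_one x
    filter_upwards [Ioo_mem_nhdsLT (show ((⌈x⌉ - 1 : ℤ) : ℝ) < x by push_cast; linarith)] with y hy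
    exact heq _ y ⟨hy.1.le, by push_cast; linarith [hy.2, Int.le_ceil x]⟩

end Ext

/-- The orbit of every point under a fixed point free increasing map is cofinal. -/
theorem exists_lt_zpow {f : H} (hf : f ∈ HPlus) (hlt : ∀ x, x < f x) (c y : ℝ) :
    ∃ n : ℤ, y ≤ (f ^ n : H) c := by
  by_contra! hn
  -- If the orbit were bounded, some orbit point would exceed `f⁻¹` of its supremum, and its image
  -- would exceed the supremum.
  set S := Set.range fun n : ℤ => (f ^ n : H) c
  have hS : IsLUB S (sSup S) := isLUB_csSup ⟨_, ⟨0, rfl⟩⟩ ⟨y, by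
    rintro _ ⟨n, rfl⟩
    exact (hn n).le⟩
  have hinv : StrictMono (f⁻¹ : H) := HPlus.inv_mem hf
  have h1 : (f⁻¹ : H) (sSup S) < sSup S := by
    have := hlt ((f⁻¹ : H) (sSup S))
    rwa [apply_inv_self] at this
  obtain ⟨_, ⟨n, rfl⟩, h2, -⟩ := hS.exists_between h1
  have h3 : (f ^ (n + 1) : H) c ≤ sSup S := hS.1 ⟨n + 1, rfl⟩
  rw [add_comm, zpow_one_add, mul_apply] at h3
  have h4 := hinv.monotone h3
  rw [inv_apply_self] at h4
  exact absurd h2 (not_lt.mpr h4)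

theorem exists_zpow_lt {f : H} (hf : f ∈ HPlus) (hlt : ∀ x, x < f x) (c y : ℝ) :
    ∃ n : ℤ, (f ^ n : H) c ≤ y := by
  obtain ⟨n, hn⟩ := exists_lt_zpow hf hlt y c
  refine ⟨-n, ?_⟩
  have hinv : StrictMono (f ^ (-n) : H) := HPlus.zpow_mem hf (-n)
  have := hinv.monotone hn
  rwa [zpow_neg, inv_apply_self, ← zpow_neg] at this

/-- Equivariant extension from a fundamental domain of a fixed point free increasing map. -/
theorem exists_equivariant {f e : H} (hf : f ∈ HPlus) (hlt : ∀ x, x < f x) (he : e ∈ HPlus)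
    (h : e 1 = f (e 0)) : ∃ θ ∈ HPlus, θ * translation 1 = f * θ ∧
      (∀ (n : ℤ) (s : ℝ), n ≤ s → s ≤ n + 1 → θ s = (f ^ n : H) (e (s - n))) ∧
      (f ∈ PL → e ∈ PL → θ ∈ PL) := by
  refine ⟨ofStrictMono (equivariantExt f e) (equivariantExt_strictMono hf he h) fun y => ?_,
    ofStrictMono_mem_HPlus _ _ _, Homeomorph.ext equivariantExt_add_one,
    fun n s => equivariantExt_eq h,
    fun h1 h2 => mem_PL_iff.mpr (equivariantExt_piecewiseAffine h1 h2 h)⟩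
  obtain ⟨m, hm⟩ := exists_zpow_lt hf hlt (e 0) y
  obtain ⟨n, hn⟩ := exists_lt_zpow hf hlt (e 0) y
  exact exists_equivariantExt_eq hf he h hm hn

/-- Fixed point free increasing homeomorphisms are conjugate to the unit translation. -/
theorem exists_conj_translation {f : H} (hf : f ∈ HPlus) (hlt : ∀ x, x < f x) :
    ∃ θ ∈ HPlus, θ * translation 1 * θ⁻¹ = f ∧ (f ∈ PL → θ ∈ PL) := by
  have ha : 0 < f 0 - 0 := sub_pos.mpr (hlt 0)
  -- The seed is the affine map of `[0, 1]` onto the fundamental domain `[0, f 0]`.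
  obtain ⟨θ, hθ, hθf, -, hθP⟩ := exists_equivariant (e := affine _ 0 ha.ne') hf hlt
    (affine_mem_PLPlus _ 0 ha).2 (by simp [affine_apply])
  exact ⟨θ, hθ, by rw [hθf, mul_inv_cancel_right], fun h => hθP h (affine_mem_PL _ _ _)⟩

/-! ### The unit translation is a product of two reversible elements -/

theorem translation_zpow (n : ℤ) (x : ℝ) : (translation 1 ^ n : H) x = x + n := by
  induction n with
  | zero => simp
  | succ n ih => rw [add_comm, zpow_one_add, mul_apply, ih, translation_apply]; push_cast; ring
  | pred n ih =>
    rw [sub_eq_add_neg, add_comm, zpow_add, mul_apply, ih, zpow_neg_one]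
    apply (translation 1).injective
    rw [apply_inv_self, translation_apply]
    push_cast
    ring

theorem translation_mem_HPlus (b : ℝ) : translation b ∈ HPlus := (translation_mem_PLPlus b).2

/-- Extension of a piecewise affine map on `[0, 1]` to a map of the line commuting with the
unit translation. -/
theorem exists_periodic {e : H} (he : e ∈ PLPlus) (h : e 1 = e 0 + 1) :
    ∃ θ ∈ PLPlus, ∀ (n : ℤ) (s : ℝ), n ≤ s → s ≤ n + 1 → θ s = e (s - n) + n := by
  obtain ⟨θ, hθ, -, hs, hP⟩ := exists_equivariant (translation_mem_HPlus 1)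
    (fun x => by rw [translation_apply]; linarith) he.2 (by rw [h, translation_apply])
  exact ⟨θ, ⟨hP (translation_mem_PLPlus 1).1 he.1, hθ⟩, fun n s h1 h2 => by
    rw [hs n s h1 h2, translation_zpow]⟩

/-- A zigzag map commuting with the unit translation, above the diagonal on `(0, 1 / 2)` and below
it on `(1 / 2, 1)`. -/
theorem exists_zigzag : ∃ Z ∈ PLPlus, ∀ (n : ℤ) (s : ℝ),
    (n ≤ s → s ≤ n + 1 / 6 → Z s = 2 * s - n) ∧
    (n + 1 / 6 ≤ s → s ≤ n + 5 / 6 → Z s = s / 2 + n / 2 + 1 / 4) ∧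
    (n + 5 / 6 ≤ s → s ≤ n + 1 → Z s = 2 * s - n - 1) := by
  have h2 : (0 : ℝ) < 2 := by norm_num
  have h3 : (0 : ℝ) < 1 / 2 := by norm_num
  obtain ⟨a, ha, hax, haP⟩ := exists_inf (affine_mem_PLPlus 2 0 h2).2
    (affine_mem_PLPlus (1 / 2) (1 / 4) h3).2
  obtain ⟨b, hb, hbx, hbP⟩ := exists_sup ha (affine_mem_PLPlus 2 (-1) h2).2
  have hb' : ∀ x, b x = max (min (2 * x) (x / 2 + 1 / 4)) (2 * x - 1) := fun x => by
    rw [hbx, hax, affine_apply, affine_apply, affine_apply]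
    ring_nf
  obtain ⟨Z, hZ, hZs⟩ := exists_periodic
    (e := b) ⟨hbP (haP (affine_mem_PL _ _ _) (affine_mem_PL _ _ _)) (affine_mem_PL _ _ _), hb⟩
    (by rw [hb', hb']; norm_num)
  refine ⟨Z, hZ, fun n s => ⟨fun h1 h2 => ?_, fun h1 h2 => ?_, fun h1 h2 => ?_⟩⟩ <;>
    rw [hZs n s (by linarith) (by linarith), hb']
  · rw [min_eq_left (by linarith), max_eq_left (by linarith)]
    ring
  · rw [min_eq_right (by linarith), max_eq_left (by linarith)]
    ring
  · rw [min_eq_right (by linarith), max_eq_right (by linarith)]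
    ring

/-- Designed to conjugate `Z` to `Z + 1 / 12`: it sends the fixed points `0`, `1 / 2` of `Z` to the
fixed points `-1 / 12`, `2 / 3` of `Z + 1 / 12`, and fixes the common breaks `1 / 6`, `5 / 6`. -/
theorem exists_zigzag_conj : ∃ κ ∈ PLPlus, ∀ (n : ℤ) (s : ℝ),
    (n ≤ s → s ≤ n + 1 / 2 → κ s = 3 / 2 * s - n / 2 - 1 / 12) ∧
    (n + 1 / 2 ≤ s → s ≤ n + 1 → κ s = s / 2 + n / 2 + 5 / 12) := by
  have h2 : (0 : ℝ) < 3 / 2 := by norm_num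
  have h3 : (0 : ℝ) < 1 / 2 := by norm_num
  obtain ⟨a, ha, hax, haP⟩ := exists_inf (affine_mem_PLPlus (3 / 2) (-1 / 12) h2).2
    (affine_mem_PLPlus (1 / 2) (5 / 12) h3).2
  have ha' : ∀ x, a x = min (3 / 2 * x - 1 / 12) (x / 2 + 5 / 12) := fun x => by
    rw [hax, affine_apply, affine_apply]
    ring_nf
  obtain ⟨κ, hκ, hκs⟩ := exists_periodic
    (e := a) ⟨haP (affine_mem_PL _ _ _) (affine_mem_PL _ _ _), ha⟩
    (by rw [ha', ha']; norm_num)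
  refine ⟨κ, hκ, fun n s => ⟨fun h1 h2 => ?_, fun h1 h2 => ?_⟩⟩ <;>
    rw [hκs n s (by linarith) (by linarith), ha']
  · rw [min_eq_left (by linarith)]
    ring
  · rw [min_eq_right (by linarith)]
    ring

/-- The unit translation as an element of `PL⁺`. -/
def unitTranslation : PLPlus := ⟨translation 1, translation_mem_PLPlus 1⟩

theorem unitTranslation_mem_R_two : unitTranslation ∈ R 2 PLPlus := by
  obtain ⟨Z, hZ, hZs⟩ := exists_zigzag
  obtain ⟨κ, hκ, hκs⟩ := exists_zigzag_conj
  have hcases : ∀ x : ℝ, ∃ n : ℤ, (n ≤ x ∧ x ≤ n + 1 / 6) ∨ (n + 1 / 6 ≤ x ∧ x ≤ n + 1 / 2) ∨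
      (n + 1 / 2 ≤ x ∧ x ≤ n + 5 / 6) ∨ (n + 5 / 6 ≤ x ∧ x ≤ n + 1) := by
    intro x
    have h1 := Int.floor_le x
    have h2 := (Int.lt_floor_add_one x).le
    refine ⟨⌊x⌋, ?_⟩
    rcases le_total x (⌊x⌋ + 1 / 6) with h | h
    · exact Or.inl ⟨h1, h⟩
    rcases le_total x (⌊x⌋ + 1 / 2) with h' | h'
    · exact Or.inr (Or.inl ⟨h, h'⟩)
    rcases le_total x (⌊x⌋ + 5 / 6) with h'' | h''
    · exact Or.inr (Or.inr (Or.inl ⟨h', h''⟩))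
    · exact Or.inr (Or.inr (Or.inr ⟨h'', h2⟩))
  -- The slopes `2` and `1 / 2` are reciprocal, so shifting by half a period exchanges `Z` and
  -- `Z⁻¹`.
  have hZr : ∀ x, Z (Z x + 1 / 2) = x + 1 / 2 := by
    intro x
    obtain ⟨n, ⟨h1, h2⟩ | ⟨h1, h2⟩ | ⟨h1, h2⟩ | ⟨h1, h2⟩⟩ := hcases x
    · rw [(hZs n x).1 h1 h2, (hZs n _).2.1 (by linarith) (by linarith)]
      ring
    · rw [(hZs n x).2.1 (by linarith) (by linarith), (hZs n _).2.2 (by linarith) (by linarith)]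
      ring
    · rw [(hZs n x).2.1 (by linarith) (by linarith),
        (hZs (n + 1) _).1 (by push_cast; linarith) (by push_cast; linarith)]
      push_cast
      ring
    · rw [(hZs n x).2.2 (by linarith) (by linarith),
        (hZs (n + 1) _).2.1 (by push_cast; linarith) (by push_cast; linarith)]
      push_cast
      ring
  have hZκ : ∀ x, Z (κ x) + 1 / 12 = κ (Z x) := by
    intro x
    obtain ⟨n, ⟨h1, h2⟩ | ⟨h1, h2⟩ | ⟨h1, h2⟩ | ⟨h1, h2⟩⟩ := hcases x
    · rw [(hZs n x).1 h1 h2, (hκs n x).1 h1 (by linarith),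
        (hκs n _).1 (by linarith) (by linarith)]
      -- Below `n + 1 / 18` the point `κ x` lies under `n`, in the previous period of `Z`.
      rcases le_total x (n + 1 / 18) with h | h
      · rw [(hZs (n - 1) _).2.2 (by push_cast; linarith) (by push_cast; linarith)]
        push_cast
        ring
      · rw [(hZs n _).1 (by linarith) (by linarith)]
        ring
    · rw [(hZs n x).2.1 (by linarith) (by linarith), (hκs n x).1 (by linarith) (by linarith),
        (hκs n _).1 (by linarith) (by linarith), (hZs n _).2.1 (by linarith) (by linarith)]
      ring
    · rw [(hZs n x).2.1 (by linarith) (by linarith), (hκs n x).2 (by linarith) (by linarith),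
        (hκs n _).2 (by linarith) (by linarith), (hZs n _).2.1 (by linarith) (by linarith)]
      ring
    · rw [(hZs n x).2.2 (by linarith) (by linarith), (hκs n x).2 (by linarith) (by linarith),
        (hκs n _).2 (by linarith) (by linarith), (hZs n _).2.2 (by linarith) (by linarith)]
      ring
  have hrev : IsReversible (⟨Z, hZ⟩ : PLPlus) := by
    refine ⟨⟨translation (1 / 2), translation_mem_PLPlus _⟩, Subtype.ext ?_⟩
    change translation (1 / 2) * Z * (translation (1 / 2))⁻¹ = Z⁻¹
    rw [mul_inv_eq_iff_eq_mul, eq_inv_mul_iff_mul_eq]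
    exact Homeomorph.ext hZr
  have h12 : (12 : ℝ) ≠ 0 := by norm_num
  -- The commutator of `κ` and `Z` is translation by `1 / 12`; scaling by `12` makes it the unit
  -- translation.
  have hkey : (⟨affine 12 0 h12, affine_mem_PLPlus 12 0 (by norm_num)⟩ : PLPlus) *
      ((⟨κ, hκ⟩ * ⟨Z, hZ⟩ * ⟨κ, hκ⟩⁻¹) * ⟨Z, hZ⟩⁻¹) *
      ⟨affine 12 0 h12, affine_mem_PLPlus 12 0 (by norm_num)⟩⁻¹ = unitTranslation := by
    rw [mul_inv_eq_iff_eq_mul]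
    refine Subtype.ext (Homeomorph.ext fun x => ?_)
    change affine 12 0 h12 (κ (Z ((κ⁻¹ : H) ((Z⁻¹ : H) x)))) = affine 12 0 h12 x + 1
    rw [← hZκ, apply_inv_self, apply_inv_self, affine_apply, affine_apply]
    ring
  rw [← hkey]
  exact conj_mem_R (mul_mem_R (conj_mem_R (mem_R_one hrev) _) (inv_mem_R (mem_R_one hrev))) _

/-! ### Products of two reversible elements in `H` and `PL` -/

/-- The reflection `x ↦ -x` reverses the translation; carry it over by the conjugacy. -/
theorem exists_reversing_of_lt {g : H} (hg : g ∈ HPlus) (hlt : ∀ x, x < g x) :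
    ∃ h : H, h * g * h⁻¹ = g⁻¹ ∧ (g ∈ PL → h ∈ PL) := by
  obtain ⟨θ, -, rfl, hP⟩ := exists_conj_translation hg hlt
  have h1 : (-1 : ℝ) ≠ 0 := by norm_num
  refine ⟨θ * affine (-1) 0 h1 * θ⁻¹, ?_, fun h =>
    PL.mul_mem (PL.mul_mem (hP h) (affine_mem_PL _ _ _)) (PL.inv_mem (hP h))⟩
  have key : translation 1 * (affine (-1) 0 h1 * translation 1) = affine (-1) 0 h1 :=
    Homeomorph.ext fun x => by
      simp only [mul_apply, translation_apply, affine_apply]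
      ring
  have key' : affine (-1) 0 h1 * translation 1 = (translation 1)⁻¹ * affine (-1) 0 h1 := by
    rw [eq_inv_mul_iff_mul_eq, key]
  calc θ * affine (-1) 0 h1 * θ⁻¹ * (θ * translation 1 * θ⁻¹) * (θ * affine (-1) 0 h1 * θ⁻¹)⁻¹
      = θ * (affine (-1) 0 h1 * translation 1) * (affine (-1) 0 h1)⁻¹ * θ⁻¹ := by group
    _ = (θ * translation 1 * θ⁻¹)⁻¹ := by rw [key']; group

/-- Every increasing homeomorphism is a quotient of two maps lying above the identity. -/
theorem exists_lt_and_lt_mul {f : H} (hf : f ∈ HPlus) :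
    ∃ k ∈ HPlus, (∀ x, x < k x) ∧ (∀ x, x < (f * k) x) ∧ (f ∈ PL → k ∈ PL) := by
  -- With `k = max f⁻¹ 1 + 1`, both `k > 1` and `k > f⁻¹` hold pointwise, and the latter says `f * k
  -- > 1`.
  obtain ⟨m, hm, hmx, hmP⟩ := exists_sup (HPlus.inv_mem hf) HPlus.one_mem
  have hf' : StrictMono f := hf
  refine ⟨translation 1 * m, HPlus.mul_mem (translation_mem_HPlus 1) hm, fun x => ?_, fun x => ?_,
    fun h => PL.mul_mem (translation_mem_PLPlus 1).1 (hmP (PL.inv_mem h) PL.one_mem)⟩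
  · rw [mul_apply, translation_apply, hmx]
    have := le_max_right ((f⁻¹ : H) x) ((1 : H) x)
    rw [one_apply] at this ⊢
    linarith
  · rw [mul_apply, mul_apply, translation_apply, hmx]
    have h1 := le_max_left ((f⁻¹ : H) x) ((1 : H) x)
    have h2 : f ((f⁻¹ : H) x) < f (max ((f⁻¹ : H) x) ((1 : H) x) + 1) := hf' (by linarith)
    rwa [apply_inv_self] at h2

theorem exists_mul_reversible (f : H) : ∃ a b h k : H, a * b = f ∧ h * a * h⁻¹ = a⁻¹ ∧
    k * b * k⁻¹ = b⁻¹ ∧ (f ∈ PL → a ∈ PL ∧ b ∈ PL ∧ h ∈ PL ∧ k ∈ PL) := by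
  rcases strictMono_or_strictAnti f with hf | hf
  · obtain ⟨k, hk, hk1, hk2, hkP⟩ := exists_lt_and_lt_mul (f := f) hf
    obtain ⟨h1, hh1, hP1⟩ := exists_reversing_of_lt (HPlus.mul_mem (x := f) hf hk) hk2
    obtain ⟨h2, hh2, hP2⟩ := exists_reversing_of_lt hk hk1
    refine ⟨f * k, k⁻¹, h1, h2, mul_inv_cancel_right f k, hh1, ?_, fun h => ?_⟩
    · rw [← conj_inv, hh2]
    · have hfk := PL.mul_mem h (hkP h)
      exact ⟨hfk, PL.inv_mem (hkP h), hP1 hfk, hP2 (hkP h)⟩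
  -- The involution `τ` built from this map dominates `f⁻¹ + 1`, so `τ (f x) ≥ x + 1`.
  · have hanti : StrictAnti (translation 1 * f⁻¹ : H) := fun x y hxy => by
      rw [← apply_inv_self f x, ← apply_inv_self f y] at hxy
      have := hf.lt_iff_gt.mp hxy
      simp only [mul_apply, translation_apply]
      linarith
    obtain ⟨τ, hτ, hτa, hτx, hτP, -⟩ := exists_involution_sup_inv hanti
    have hmem : τ * f ∈ HPlus := mul_strictAnti hτa hf
    have hlt : ∀ x, x < (τ * f) x := by
      intro x
      rw [mul_apply, hτx]
      refine lt_of_lt_of_le ?_ (le_max_left _ _)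
      rw [mul_apply, translation_apply, inv_apply_self]
      linarith
    obtain ⟨h, hh, hP⟩ := exists_reversing_of_lt hmem hlt
    refine ⟨τ, τ * f, 1, h, by rw [← mul_assoc, hτ, one_mul], ?_, hh, fun hfP => ?_⟩
    · rw [one_mul, inv_one, mul_one]; exact eq_inv_of_mul_eq_one_left hτ
    · have hτP' := hτP (PL.mul_mem (translation_mem_PLPlus 1).1 (PL.inv_mem hfP))
      have := PL.mul_mem hτP' hfP
      exact ⟨hτP', this, PL.one_mem, hP this⟩

theorem R_two_H : R 2 H = Set.univ := by
  refine Set.eq_univ_of_forall fun f => ?_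
  obtain ⟨a, b, h, k, rfl, ha, hb, -⟩ := exists_mul_reversible f
  exact mul_mem_R (mem_R_one ⟨h, ha⟩) (mem_R_one ⟨k, hb⟩)

theorem R_two_PL : R 2 PL = Set.univ := by
  refine Set.eq_univ_of_forall fun ⟨f, hf⟩ => ?_
  obtain ⟨a, b, h, k, rfl, ha, hb, hP⟩ := exists_mul_reversible f
  obtain ⟨pa, pb, ph, pk⟩ := hP hf
  exact mul_mem_R (mem_R_one (a := (⟨a, pa⟩ : PL)) ⟨⟨h, ph⟩, Subtype.ext ha⟩)
    (mem_R_one (a := (⟨b, pb⟩ : PL)) ⟨⟨k, pk⟩, Subtype.ext hb⟩)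

/-! ### Products of reversible elements in `PL⁺` -/

theorem mem_R_two_PLPlus_of_lt (g : PLPlus) (hlt : ∀ x, x < (g : H) x) : g ∈ R 2 PLPlus := by
  obtain ⟨θ, hθ, hθg, hP⟩ := exists_conj_translation g.2.2 hlt
  have : (⟨θ, hP g.2.1, hθ⟩ : PLPlus) * unitTranslation * (⟨θ, hP g.2.1, hθ⟩ : PLPlus)⁻¹ = g :=
    Subtype.ext hθg
  rw [← this]
  exact conj_mem_R unitTranslation_mem_R_two _

theorem R_four_PLPlus : R 4 PLPlus = Set.univ := by
  refine Set.eq_univ_of_forall fun f => ?_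
  obtain ⟨k, hk, hk1, hk2, hkP⟩ := exists_lt_and_lt_mul f.2.2
  set k' : PLPlus := ⟨k, hkP f.2.1, hk⟩
  rw [← mul_inv_cancel_right f k']
  exact mul_mem_R (mem_R_two_PLPlus_of_lt (f * k') hk2)
    (inv_mem_R (mem_R_two_PLPlus_of_lt k' hk1))

/-! ### Products of two reversible elements in `H⁺` -/

/-- The order convex hull of the orbit of `c` under `f`. -/
def orbitHull (f : H) (c : ℝ) : Set ℝ :=
  {y | ∃ m n : ℤ, (f ^ m : H) c ≤ y ∧ y ≤ (f ^ n : H) c}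

theorem orbitHull_inv (f : H) (c : ℝ) : orbitHull f⁻¹ c = orbitHull f c := by
  ext y
  constructor <;> rintro ⟨m, n, h⟩ <;> refine ⟨-m, -n, ?_⟩
  · rwa [zpow_neg, zpow_neg, ← inv_zpow, ← inv_zpow]
  · rwa [inv_zpow, inv_zpow, zpow_neg, zpow_neg, inv_inv, inv_inv]

theorem self_mem_orbitHull (f : H) (c : ℝ) : c ∈ orbitHull f c :=
  ⟨0, 0, le_of_eq (by rw [zpow_zero, one_apply]), le_of_eq (by rw [zpow_zero, one_apply])⟩

theorem orbitHull_symm {f : H} (hf : f ∈ HPlus) {x y : ℝ} (h : y ∈ orbitHull f x) :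
    x ∈ orbitHull f y := by
  obtain ⟨m, n, h1, h2⟩ := h
  have hpow : ∀ n : ℤ, StrictMono (f ^ n : H) := fun n => HPlus.zpow_mem hf n
  refine ⟨-n, -m, ?_, ?_⟩
  · have := (hpow (-n)).monotone h2
    rwa [← mul_apply, ← zpow_add, neg_add_cancel, zpow_zero, one_apply] at this
  · have := (hpow (-m)).monotone h1
    rwa [← mul_apply, ← zpow_add, neg_add_cancel, zpow_zero, one_apply] at this

theorem orbitHull_trans {f : H} (hf : f ∈ HPlus) {x y z : ℝ} (h : y ∈ orbitHull f x)
    (h' : z ∈ orbitHull f y) : z ∈ orbitHull f x := by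
  obtain ⟨m, n, h1, h2⟩ := h
  obtain ⟨a, b, h3, h4⟩ := h'
  have hpow : ∀ n : ℤ, StrictMono (f ^ n : H) := fun n => HPlus.zpow_mem hf n
  refine ⟨a + m, b + n, ?_, ?_⟩
  · rw [zpow_add, mul_apply]
    exact ((hpow a).monotone h1).trans h3
  · rw [zpow_add, mul_apply]
    exact h4.trans ((hpow b).monotone h2)

theorem orbitHull_convex {f : H} {c x y z : ℝ} (hx : x ∈ orbitHull f c) (hy : y ∈ orbitHull f c)
    (hxz : x ≤ z) (hzy : z ≤ y) : z ∈ orbitHull f c := by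
  obtain ⟨m, -, h1, -⟩ := hx
  obtain ⟨-, n, -, h2⟩ := hy
  exact ⟨m, n, h1.trans hxz, hzy.trans h2⟩

/-- The setoid whose classes are the convex hulls of the orbits of `f`. -/
def orbitHullSetoid (f : H) (hf : f ∈ HPlus) : Setoid ℝ where
  r x y := y ∈ orbitHull f x
  iseqv := ⟨self_mem_orbitHull f, orbitHull_symm hf, orbitHull_trans hf⟩

theorem exists_orbit_coordinate_of_lt {f : H} (hf : f ∈ HPlus) {c : ℝ} (hc : c < f c) :
    ∃ θ : ℝ → ℝ, StrictMono θ ∧ (∀ s, θ (s + 1) = f (θ s)) ∧ Set.range θ = orbitHull f c := by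
  have ha : 0 < f c - c := sub_pos.mpr hc
  have he : affine _ c ha.ne' ∈ HPlus := (affine_mem_PLPlus _ c ha).2
  have h0 : affine _ c ha.ne' 0 = c := by simp [affine_apply]
  have h1 : affine _ c ha.ne' 1 = f (affine _ c ha.ne' 0) := by rw [h0]; simp [affine_apply]
  have hm := equivariantExt_strictMono hf he h1
  refine ⟨equivariantExt f (affine _ c ha.ne'), hm, equivariantExt_add_one,
    Set.Subset.antisymm ?_ ?_⟩
  · rintro _ ⟨s, rfl⟩
    refine ⟨⌊s⌋, ⌊s⌋ + 1, ?_, ?_⟩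
    · have := hm.monotone (Int.floor_le s)
      rwa [equivariantExt_int h1, h0] at this
    · have := hm.monotone (Int.lt_floor_add_one s).le
      rwa [← Int.cast_one, ← Int.cast_add, equivariantExt_int h1, h0] at this
  · rintro y ⟨m, n, h2, h3⟩
    exact exists_equivariantExt_eq hf he h1 (by rwa [h0]) (by rwa [h0])

/-- If `f` moves `c` down, the coordinate of `f⁻¹` is run backwards; if `f` fixes `c`, the hull is a
point and `θ` is constant. -/
theorem exists_orbit_coordinate {f : H} (hf : f ∈ HPlus) (c : ℝ) :
    ∃ θ : ℝ → ℝ, (StrictMono θ ∨ StrictAnti θ ∨ ∀ s, θ s = c) ∧ (∀ s, θ (s + 1) = f (θ s)) ∧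
      Set.range θ = orbitHull f c := by
  rcases lt_trichotomy (f c) c with h | h | h
  · have hinv : StrictMono (f⁻¹ : H) := HPlus.inv_mem hf
    have h' : c < (f⁻¹ : H) c := by
      have := hinv h
      rwa [inv_apply_self] at this
    obtain ⟨θ, hθ, hθf, hr⟩ := exists_orbit_coordinate_of_lt (HPlus.inv_mem hf) h'
    refine ⟨fun s => θ (-s), Or.inr (Or.inl fun x y hxy => hθ (neg_lt_neg hxy)), fun s => ?_, ?_⟩
    · have := hθf (-(s + 1))
      rw [show -(s + 1) + 1 = -s by ring] at this
      change θ (-(s + 1)) = f (θ (-s))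
      rw [this, apply_inv_self]
    · rw [← orbitHull_inv, ← hr]
      exact (neg_surjective (G := ℝ)).range_comp θ
  · have hp : ∀ n : ℤ, (f ^ n : H) c = c := by
      intro n
      induction n with
      | zero => rw [zpow_zero, one_apply]
      | succ n ih => rw [zpow_add_one, mul_apply, h, ih]
      | pred n ih =>
        rw [zpow_sub_one, mul_apply]
        nth_rw 1 [← h]
        rw [inv_apply_self, ih]
    refine ⟨fun _ => c, Or.inr (Or.inr fun _ => rfl), fun _ => h.symm, ?_⟩
    ext y
    simp only [Set.range_const, Set.mem_singleton_iff, orbitHull, hp, Set.mem_ofPred_eq,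
      exists_const]
    exact ⟨fun hy => ⟨hy.ge, hy.le⟩, fun hy => le_antisymm hy.2 hy.1⟩
  · obtain ⟨θ, hθ, hθf, hr⟩ := exists_orbit_coordinate_of_lt hf h
    exact ⟨θ, Or.inl hθ, hθf, hr⟩

/-- Every increasing homeomorphism is the image of the unit translation under an endomorphism of
`H⁺`. -/
theorem exists_hom_translation {f : H} (hf : f ∈ HPlus) :
    ∃ φ : HPlus →* HPlus, φ ⟨translation 1, translation_mem_HPlus 1⟩ = ⟨f, hf⟩ := by
  choose θ hθ hθf hθr using exists_orbit_coordinate hf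
  let st := orbitHullSetoid f hf
  let rep : ℝ → ℝ := fun x => (Quotient.mk st x).out
  have hrep : ∀ x, x ∈ orbitHull f (rep x) := fun x => Quotient.mk_out (s := st) x
  have hrep' : ∀ {x y}, y ∈ orbitHull f (rep x) → rep y = rep x := fun {x y} h =>
    congrArg Quotient.out (Quotient.sound (s := st)
      (orbitHull_symm hf (orbitHull_trans hf (orbitHull_symm hf (hrep x)) h)))
  have hmem : ∀ x s, θ (rep x) s ∈ orbitHull f (rep x) := fun x s => by
    rw [← hθr]; exact ⟨s, rfl⟩
  have hτ' : ∀ x, ∃ s, θ (rep x) s = x := fun x => by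
    have := hrep x
    rwa [← hθr] at this
  choose τ hτ using hτ'
  -- On each hull `F u` is `u` read in that hull's coordinate, so it preserves hulls. One
  -- representative per hull makes the coordinate common to all its points.
  let F : HPlus → ℝ → ℝ := fun u x => θ (rep x) ((u : H) (τ x))
  have hFθ : ∀ u x s, F u (θ (rep x) s) = θ (rep x) ((u : H) s) := by
    intro u x s
    have h1 := hrep' (hmem x s)
    have h2 := hτ (θ (rep x) s)
    simp only [F]
    rw [h1] at h2 ⊢
    rcases hθ (rep x) with h | h | h
    · rw [h.injective h2]
    · rw [h.injective h2]
    · rw [h, h]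
  have hFmul : ∀ u v x, F (u * v) x = F u (F v x) := fun u v x => (hFθ u x _).symm
  have hFone : ∀ x, F 1 x = x := hτ
  have hFmono : ∀ u, StrictMono (F u) := by
    intro u x y hxy
    have hu : StrictMono (u : H) := u.2
    by_cases hxy' : rep y = rep x
    · have hx := hτ x
      have hy := hτ y
      simp only [F]
      rw [hxy'] at hy ⊢
      rcases hθ (rep x) with h | h | h
      · exact h (hu (h.lt_iff_lt.mp (by rwa [hx, hy])))
      · exact h (hu (h.lt_iff_gt.mp (by rwa [hx, hy])))
      · rw [h] at hx hy
        exact absurd hxy (by rw [← hx, ← hy]; exact lt_irrefl _)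
    -- Points of different hulls keep their order, because hulls are disjoint and order convex and
    -- `F u` preserves each.
    · by_contra! hle
      have h1 : F u x ∈ orbitHull f (rep x) := hmem x _
      have h2 : F u y ∈ orbitHull f (rep y) := hmem y _
      rcases le_total (F u y) x with h | h
      · exact hxy' (hrep' (orbitHull_convex h2 (hrep y) h hxy.le)).symm
      · exact hxy' ((hrep' h2).symm.trans (hrep' (orbitHull_convex (hrep x) h1 h hle)))
  have hFsurj : ∀ u, Function.Surjective (F u) := fun u y =>
    ⟨F u⁻¹ y, by rw [← hFmul, mul_inv_cancel, hFone]⟩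
  refine ⟨⟨⟨fun u => ⟨ofStrictMono (F u) (hFmono u) (hFsurj u), hFmono u⟩, ?_⟩, ?_⟩, ?_⟩
  · exact Subtype.ext (Homeomorph.ext hFone)
  · exact fun u v => Subtype.ext (Homeomorph.ext (hFmul u v))
  · refine Subtype.ext (Homeomorph.ext fun x => ?_)
    change θ (rep x) (τ x + 1) = f x
    rw [hθf, hτ]

/-- Homomorphisms preserve reversibility, so the factorization of the unit translation in `PL⁺`
passes to `f`. -/
theorem R_two_HPlus : R 2 HPlus = Set.univ := by
  refine Set.eq_univ_of_forall fun ⟨f, hf⟩ => ?_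
  obtain ⟨φ, hφ⟩ := exists_hom_translation hf
  rw [← hφ]
  exact map_mem_R φ (map_mem_R (Subgroup.inclusion (inf_le_right : PLPlus ≤ HPlus))
    unitTranslation_mem_R_two)

end RealLineHomeo

theorem theoremT :
    (RealLineHomeo.R 2 RealLineHomeo.HPlus = Set.univ ∧
      RealLineHomeo.R 2 RealLineHomeo.H = Set.univ) ∧
    (∀ n : ℕ, 1 ≤ n →
      RealLineHomeo.R n RealLineHomeo.PLFPlus = {1} ∧
      RealLineHomeo.I (2 * n) RealLineHomeo.PLF = RealLineHomeo.R n RealLineHomeo.PLF) ∧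
    (RealLineHomeo.R 4 RealLineHomeo.PLPlus = Set.univ ∧
      RealLineHomeo.R 2 RealLineHomeo.PL = Set.univ) := by
  exact ⟨⟨RealLineHomeo.R_two_HPlus, RealLineHomeo.R_two_H⟩,
    fun n _ => ⟨RealLineHomeo.R_PLFPlus n,
      RealLineHomeo.I_two_mul_eq_R RealLineHomeo.isReversible_PLF_eq_mul n⟩,
    RealLineHomeo.R_four_PLPlus, RealLineHomeo.R_two_PL⟩
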